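/- Let $\mathscr{H}$ be a complex Hilbert space. For a compact operator $X$ on $\mathscr{H}$ let $s_1(X)\ge s_2(X)\ge\cdots\ge 0$ be its singular values, i.e. the eigenvalues of $|X|=(X^*X)^{1/2}$ repeated according to multiplicity. For $0<p<\infty$ put $\|X\|_p=\big(\sum_j s_j(X)^p\big)^{1/p}$, and let $\mathbb{B}_p(\mathscr{H})$ be the set of compact operators $X$ on $\mathscr{H}$ with $\|X\|_p<\infty$. Let $0<p<\infty$, let $s,t\ge 1$ be integers, and let $X_1,\ldots,X_s,Y_1,\ldots,Y_t\in\mathbb{B}_p(\mathscr{H})$ satisfy \[ \sum_{i=1}^s|X_i|^2=\sum_{j=1}^t|Y_j|^2 . \] If $p\ge 2$, then \[ s^{1-\frac p2}\sum_{j=1}^t\|Y_j\|_p^p\;\le\;\sum_{i=1}^s\|X_i\|_p^p\;\le\; t^{\frac p2-1}\sum_{j=1}^t\|Y_j\|_p^p . \] If $0<p\le 2$, then both inequalities are reversed: \[ t^{\frac p2-1}\sum_{j=1}^t\|Y_j\|_p^p\;\le\;\sum_{i=1}^s\|X_i\|_p^p\;\le\; s^{1-\frac p2}\sum_{j=1}^t\|Y_j\|_p^p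 . \] -/

import Mathlib

open scoped ENNReal

section Schatten

variable {H : Type*} [NormedAddCommGroup H] [InnerProductSpace ℂ H] [CompleteSpace H]

/-- For `σ > 0`: the number of times `σ` occurs among the singular values of the compact operator
`X` (the eigenvalues of `|X| = (X* X)^(1/2)`, repeated according to multiplicity), that is, the
dimension of the eigenspace of `X* X` for the eigenvalue `σ ^ 2`. -/
noncomputable def singularMultiplicity (X : H →L[ℂ] H) (σ : ℝ) : ℕ :=
  Module.finrank ℂ
    (Module.End.eigenspace ((ContinuousLinearMap.adjoint X * X : H →L[ℂ] H) : H →ₗ[ℂ] H)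
      ((σ ^ 2 : ℝ) : ℂ))

/-- The extended Schatten `p`-(quasi)norm `(∑ⱼ sⱼ(X) ^ p) ^ (1 / p) ∈ [0, ∞]` of a compact
operator `X`. The sum over the singular values with repetition is written as a sum over the
positive reals `σ`, each weighted by its multiplicity; zero singular values contribute nothing. -/
noncomputable def eSchattenNorm (p : ℝ) (X : H →L[ℂ] H) : ℝ≥0∞ :=
  (∑' σ : Set.Ioi (0 : ℝ),
    (singularMultiplicity X σ : ℝ≥0∞) * ENNReal.ofReal (σ : ℝ) ^ p) ^ (1 / p)

/-- The Schatten class `𝔹_p(H)`: compact operators `X` on `H` with `‖X‖_p < ∞`. -/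
structure MemSchatten (p : ℝ) (X : H →L[ℂ] H) : Prop where
  isCompactOperator : IsCompactOperator X
  eSchattenNorm_lt_top : eSchattenNorm p X < ∞

/-- The Schatten `p`-(quasi)norm `‖X‖_p` as a real number, for `X` in `𝔹_p(H)`. -/
noncomputable def schattenNorm (p : ℝ) (X : H →L[ℂ] H) : ℝ :=
  (eSchattenNorm p X).toReal

end Schatten

/-!
Put `T = ∑ |X i| ^ 2 = ∑ |Y j| ^ 2` and `q = p / 2`, so that `‖X‖_p ^ p = Tr (|X| ^ 2) ^ q`. Both
sums of traces are compared with `Tr T ^ q`. For `q ≥ 1`, the power mean inequality in an eigenbasis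
of `T`, followed by Peierls' inequality, gives `Tr T ^ q ≤ t ^ (q - 1) * ∑ Tr (|Y j| ^ 2) ^ q`.
McCarthy's inequality `∑ Tr (|X i| ^ 2) ^ q ≤ Tr T ^ q` follows from Jensen's inequality. Write
`T` as a sum of rank one operators `v k ⊗ v k`, with `v k` running over rescaled eigenvectors of all
the `|X i| ^ 2`, and let `e l` be an eigenbasis of `T` with eigenvalues `α l`. Then `‖v k‖ ^ 2` is
the average of the `α l` with the weights `⟨v k, e l⟩ ^ 2 / α l`, whose sum over `l` is at most `1`
because `v k ⊗ v k ≤ T`, and whose sum over `k` is `1`. Both inequalities are reversed for `q ≤ 1`.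
-/

open Module.End

open scoped NNReal InnerProductSpace ComplexOrder

universe u v

section Jensen

variable {ι : Type*} {w z : ι → ℝ≥0∞} {q : ℝ}

theorem rpow_tsum_mul_le_tsum_mul_rpow (hq : 1 ≤ q) (hw : ∑' i, w i ≤ 1) :
    (∑' i, w i * z i) ^ q ≤ ∑' i, w i * z i ^ q := by
  have hq0 : 0 < q := by linarith
  rw [← ENNReal.le_rpow_inv_iff hq0, ENNReal.tsum_eq_iSup_sum]
  refine iSup_le fun s => ?_
  have weights_le_one : (∑ i ∈ s, w i) ^ (1 - q⁻¹) ≤ 1 :=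
    ENNReal.rpow_le_one ((ENNReal.sum_le_tsum s).trans hw)
      (sub_nonneg.2 (inv_le_one_of_one_le₀ hq))
  calc ∑ i ∈ s, w i * z i
      ≤ (∑ i ∈ s, w i) ^ (1 - q⁻¹) * (∑ i ∈ s, w i * z i ^ q) ^ q⁻¹ :=
        ENNReal.inner_le_weight_mul_Lp_of_nonneg s hq w z
    _ ≤ 1 * (∑' i, w i * z i ^ q) ^ q⁻¹ := by
        gcongr
        exact ENNReal.sum_le_tsum s
    _ = (∑' i, w i * z i ^ q) ^ q⁻¹ := one_mul _

theorem tsum_mul_rpow_le_rpow_tsum_mul (hq0 : 0 < q) (hq : q ≤ 1) (hw : ∑' i, w i ≤ 1) :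
    ∑' i, w i * z i ^ q ≤ (∑' i, w i * z i) ^ q := by
  have h := rpow_tsum_mul_le_tsum_mul_rpow (z := fun i => z i ^ q) ((one_le_inv₀ hq0).2 hq) hw
  simp only [ENNReal.rpow_rpow_inv hq0.ne'] at h
  rwa [← ENNReal.rpow_inv_le_iff hq0]

theorem sum_rpow_le_card_rpow_mul_rpow_sum (s : Finset ι) (f : ι → ℝ≥0∞) (hq0 : 0 < q)
    (hq : q ≤ 1) : ∑ i ∈ s, f i ^ q ≤ (s.card : ℝ≥0∞) ^ (1 - q) * (∑ i ∈ s, f i) ^ q := by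
  have h := ENNReal.rpow_sum_le_const_mul_sum_rpow s (fun i => f i ^ q) ((one_le_inv₀ hq0).2 hq)
  simp only [ENNReal.rpow_rpow_inv hq0.ne'] at h
  rwa [ENNReal.rpow_inv_le_iff hq0, ENNReal.mul_rpow_of_nonneg _ _ hq0.le, ← ENNReal.rpow_mul,
    sub_mul, inv_mul_cancel₀ hq0.ne', one_mul] at h

end Jensen

theorem ne_top_and_sum_toReal_rpow_le {m n : Type*} [Fintype m] [Fintype n] {x : m → ℝ≥0∞}
    {y : n → ℝ≥0∞} {p r : ℝ} {k : ℕ} (hp : 0 < p) (hr : 0 ≤ r) (hy : ∀ j, y j ≠ ∞)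
    (h : ∑ i, x i ^ p ≤ (k : ℝ≥0∞) ^ r * ∑ j, y j ^ p) :
    (∀ i, x i ≠ ∞) ∧ ∑ i, (x i).toReal ^ p ≤ (k : ℝ) ^ r * ∑ j, (y j).toReal ^ p := by
  have hyp : ∀ j, y j ^ p ≠ ∞ := fun j => ENNReal.rpow_ne_top_of_nonneg hp.le (hy j)
  have bound_ne_top : (k : ℝ≥0∞) ^ r * ∑ j, y j ^ p ≠ ∞ :=
    ENNReal.mul_ne_top (ENNReal.rpow_ne_top_of_nonneg hr (ENNReal.natCast_ne_top k))
      (ENNReal.sum_ne_top.2 fun j _ => hyp j)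
  have hxp : ∀ i, x i ^ p ≠ ∞ := fun i =>
    ENNReal.sum_ne_top.1 (ne_top_of_le_ne_top bound_ne_top h) i (Finset.mem_univ i)
  refine ⟨fun i hi => hxp i (by rw [hi, ENNReal.top_rpow_of_pos hp]), ?_⟩
  simpa only [ENNReal.toReal_mul, ← ENNReal.toReal_rpow, ENNReal.toReal_natCast,
    ENNReal.toReal_sum fun i _ => hxp i, ENNReal.toReal_sum fun j _ => hyp j] using
    ENNReal.toReal_mono bound_ne_top h

theorem tsum_comp_eq_tsum_card_fiber_mul {ι κ : Type*} (a : ι → κ) (f : κ → ℝ≥0∞) :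
    ∑' l, f (a l) = ∑' c, (ENat.card (a ⁻¹' {c}) : ℝ≥0∞) * f c := by
  rw [← ENNReal.tsum_fiberwise _ a]
  refine tsum_congr fun c => ?_
  rw [← ENNReal.tsum_const]
  exact tsum_congr fun l => by rw [show a l = c from l.2]

theorem tsum_Ioi_toNNReal_sq {f : ℝ≥0 → ℝ≥0∞} (hf : f 0 = 0) :
    ∑' σ : Set.Ioi (0 : ℝ), f (Real.toNNReal σ ^ 2) = ∑' c, f c := by
  have sq_injective : Function.Injective fun σ : Set.Ioi (0 : ℝ) => Real.toNNReal σ ^ 2 :=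
    fun σ τ h => Subtype.ext <|
      (Real.toNNReal_eq_toNNReal_iff σ.2.le τ.2.le).1 (pow_left_injective two_ne_zero h)
  refine sq_injective.tsum_eq fun c hc => ⟨⟨NNReal.sqrt c, ?_⟩, ?_⟩
  · have : c ≠ 0 := by
      rintro rfl
      exact hc hf
    simpa [pos_iff_ne_zero] using this
  · exact (congrArg (· ^ 2) Real.toNNReal_coe).trans (NNReal.sq_sqrt c)

theorem tsum_ofReal_of_hasSum {ι : Type*} {f : ι → ℝ} {a : ℝ} (hf : ∀ i, 0 ≤ f i)
    (h : HasSum f a) : ∑' i, ENNReal.ofReal (f i) = ENNReal.ofReal a := by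
  rw [← ENNReal.ofReal_tsum_of_nonneg hf h.summable, h.tsum_eq]

section InnerProductSpace

variable {𝕜 H ι : Type*} [RCLike 𝕜] [NormedAddCommGroup H] [InnerProductSpace 𝕜 H]

theorem enorm_sq_eq_ofReal (x : H) : ‖x‖ₑ ^ 2 = ENNReal.ofReal (‖x‖ ^ 2) := by
  rw [ENNReal.ofReal_pow (norm_nonneg x), ofReal_norm]

theorem enorm_inner_comm (x y : H) : ‖⟪x, y⟫_𝕜‖ₑ = ‖⟪y, x⟫_𝕜‖ₑ := by
  rw [← ofReal_norm, norm_inner_symm, ofReal_norm]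

theorem enorm_sqrt_smul_sq (a : ℝ≥0) (x : H) :
    ‖((NNReal.sqrt a : ℝ) : 𝕜) • x‖ₑ ^ 2 = a * ‖x‖ₑ ^ 2 := by
  rw [enorm_sq_eq_ofReal, enorm_sq_eq_ofReal, norm_smul, mul_pow,
    RCLike.norm_of_nonneg (NNReal.coe_nonneg _), ← NNReal.coe_pow, NNReal.sq_sqrt,
    ENNReal.ofReal_mul a.coe_nonneg, ENNReal.ofReal_coe_nnreal]

theorem tsum_enorm_inner_sq (b : HilbertBasis ι 𝕜 H) (x : H) :
    ∑' l, ‖⟪b l, x⟫_𝕜‖ₑ ^ 2 = ‖x‖ₑ ^ 2 := by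
  have parseval : HasSum (fun l => ‖⟪b l, x⟫_𝕜‖ ^ 2) (‖x‖ ^ 2) := by
    simpa [b.repr_apply_apply] using lp.hasSum_norm (by norm_num) (b.repr x)
  simp only [enorm_sq_eq_ofReal]
  exact tsum_ofReal_of_hasSum (fun l => by positivity) parseval

theorem enorm_hilbertBasis (b : HilbertBasis ι 𝕜 H) (l : ι) : ‖b l‖ₑ = 1 := by
  rw [← ofReal_norm, b.orthonormal.1 l, ENNReal.ofReal_one]

theorem tsum_tsum_enorm_inner_sq_mul {κ : Type*} (b : HilbertBasis ι 𝕜 H)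
    (e : HilbertBasis κ 𝕜 H) (c : ι → ℝ≥0∞) :
    ∑' k, ∑' l, ‖⟪b l, e k⟫_𝕜‖ₑ ^ 2 * c l = ∑' l, c l := by
  rw [ENNReal.tsum_comm]
  refine tsum_congr fun l => ?_
  simp only [ENNReal.tsum_mul_right, enorm_inner_comm (b l), tsum_enorm_inner_sq,
    enorm_hilbertBasis, one_pow, one_mul]

/-- The quadratic form `⟨T x, x⟩` of an operator, valued in `[0, ∞]` so that its sums over infinite
families need no summability. It carries no information where the form is negative. -/
noncomputable def quadForm (T : H →L[𝕜] H) (x : H) : ℝ≥0∞ :=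
  ENNReal.ofReal (T.reApplyInnerSelf x)

/-- `b` is a Hilbert basis of eigenvectors of `T`, with nonnegative eigenvalues `a`, each repeated
according to its multiplicity. -/
def IsEigenbasis (T : H →L[𝕜] H) (b : HilbertBasis ι 𝕜 H) (a : ι → ℝ≥0) : Prop :=
  ∀ l, T (b l) = ((a l : ℝ) : 𝕜) • b l

namespace IsEigenbasis

section QuadForm

variable {T : H →L[𝕜] H} {b : HilbertBasis ι 𝕜 H} {a : ι → ℝ≥0}

theorem inner_apply (h : IsEigenbasis T b a) (l : ι) (x : H) :
    ⟪b l, T x⟫_𝕜 = ((a l : ℝ) : 𝕜) * ⟪b l, x⟫_𝕜 := by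
  have expansion : HasSum (fun k => ⟪b l, T (b.repr x k • b k)⟫_𝕜) ⟪b l, T x⟫_𝕜 :=
    ((b.hasSum_repr x).mapL T).mapL (innerSL 𝕜 (b l))
  have term_eq : ∀ k, ⟪b l, T (b.repr x k • b k)⟫_𝕜 =
      ⟪b k, x⟫_𝕜 * (((a k : ℝ) : 𝕜) * ⟪b l, b k⟫_𝕜) := fun k => by
    rw [map_smul, h k, inner_smul_right, inner_smul_right, b.repr_apply_apply]
  rw [← expansion.tsum_eq, tsum_eq_single l fun k hk => ?_, term_eq,
    inner_self_eq_one_of_norm_eq_one (b.orthonormal.1 l), mul_one, mul_comm]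
  rw [term_eq, b.orthonormal.2 hk.symm, mul_zero, mul_zero]

theorem hasSum_reApplyInnerSelf (h : IsEigenbasis T b a) (x : H) :
    HasSum (fun l => a l * ‖⟪b l, x⟫_𝕜‖ ^ 2) (T.reApplyInnerSelf x) := by
  have expansion := (b.hasSum_inner_mul_inner (T x) x).mapL RCLike.reCLM
  have term_eq : ∀ l, RCLike.re (⟪T x, b l⟫_𝕜 * ⟪b l, x⟫_𝕜) = a l * ‖⟪b l, x⟫_𝕜‖ ^ 2 :=
    fun l => by
      rw [← inner_conj_symm (T x) (b l), h.inner_apply, map_mul (starRingEnd 𝕜), mul_assoc,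
        RCLike.conj_mul, RCLike.conj_ofReal]
      norm_cast
  simp only [RCLike.reCLM_apply, term_eq] at expansion
  exact expansion

theorem quadForm_eq_tsum (h : IsEigenbasis T b a) (x : H) :
    quadForm T x = ∑' l, (a l : ℝ≥0∞) * ‖⟪b l, x⟫_𝕜‖ₑ ^ 2 := by
  rw [quadForm, ← tsum_ofReal_of_hasSum (fun l => by positivity) (h.hasSum_reApplyInnerSelf x)]
  simp only [ENNReal.ofReal_mul (NNReal.coe_nonneg _), ENNReal.ofReal_coe_nnreal,
    enorm_sq_eq_ofReal]

theorem quadForm_self (h : IsEigenbasis T b a) (l : ι) : quadForm T (b l) = a l := by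
  rw [quadForm, ContinuousLinearMap.reApplyInnerSelf_apply, h l, inner_smul_left,
    inner_self_eq_one_of_norm_eq_one (b.orthonormal.1 l)]
  simp

/-- **Peierls' inequality**, convex case. -/
theorem tsum_quadForm_rpow_le (h : IsEigenbasis T b a) {κ : Type*} (e : HilbertBasis κ 𝕜 H)
    {q : ℝ} (hq : 1 ≤ q) : ∑' k, quadForm T (e k) ^ q ≤ ∑' l, (a l : ℝ≥0∞) ^ q := by
  rw [← tsum_tsum_enorm_inner_sq_mul b e]
  refine ENNReal.tsum_le_tsum fun k => ?_
  simp only [h.quadForm_eq_tsum, mul_comm (a _ : ℝ≥0∞)]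
  exact rpow_tsum_mul_le_tsum_mul_rpow hq (by simp [tsum_enorm_inner_sq, enorm_hilbertBasis])

/-- **Peierls' inequality**, concave case. -/
theorem tsum_rpow_le_tsum_quadForm_rpow (h : IsEigenbasis T b a) {κ : Type*}
    (e : HilbertBasis κ 𝕜 H) {q : ℝ} (hq0 : 0 < q) (hq : q ≤ 1) :
    ∑' l, (a l : ℝ≥0∞) ^ q ≤ ∑' k, quadForm T (e k) ^ q := by
  rw [← tsum_tsum_enorm_inner_sq_mul b e]
  refine ENNReal.tsum_le_tsum fun k => ?_
  simp only [h.quadForm_eq_tsum, mul_comm (a _ : ℝ≥0∞)]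
  exact tsum_mul_rpow_le_rpow_tsum_mul hq0 hq (by simp [tsum_enorm_inner_sq, enorm_hilbertBasis])

end QuadForm

section Frame

variable {κ : Type*} {T : H →L[𝕜] H} {e : HilbertBasis ι 𝕜 H} {α : ι → ℝ≥0} {q : ℝ}

/-- Testing `v ⊗ v ≤ T` against the truncation `u` to `s` of `T⁻¹ v` gives `S ^ 2 ≤ S`, where
`S = ⟨v, u⟩ = ⟨T u, u⟩`. -/
theorem sum_inv_mul_norm_inner_sq_le_one (h : IsEigenbasis T e α) {v : H}
    (hv : ∀ x, ‖⟪v, x⟫_𝕜‖ₑ ^ 2 ≤ quadForm T x) (s : Finset ι) :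
    ∑ l ∈ s, (α l : ℝ)⁻¹ * ‖⟪v, e l⟫_𝕜‖ ^ 2 ≤ 1 := by
  set S : ℝ := ∑ l ∈ s, (α l : ℝ)⁻¹ * ‖⟪v, e l⟫_𝕜‖ ^ 2 with hS
  have S_nonneg : 0 ≤ S := Finset.sum_nonneg fun l _ => by positivity
  let u : H := ∑ l ∈ s, (((α l : ℝ)⁻¹ : 𝕜) * ⟪e l, v⟫_𝕜) • e l
  have inner_v_u : ⟪v, u⟫_𝕜 = (S : 𝕜) := by
    rw [inner_sum, hS]
    push_cast
    refine Finset.sum_congr rfl fun l _ => ?_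
    rw [inner_smul_right, mul_assoc, ← inner_conj_symm (e l) v, RCLike.conj_mul]
  have inner_Tu_u : ⟪T u, u⟫_𝕜 = (S : 𝕜) := by
    simp only [u, map_sum, map_smul, h _, smul_smul]
    rw [e.orthonormal.inner_sum, hS]
    push_cast
    refine Finset.sum_congr rfl fun l _ => ?_
    rw [← inner_conj_symm (e l) v]
    simp only [map_mul, map_inv₀, RCLike.conj_ofReal, RCLike.conj_conj]
    rw [← RCLike.mul_conj]
    by_cases hα : (α l : ℝ) = 0
    · simp [hα]
    · have : ((α l : ℝ) : 𝕜) ≠ 0 := by exact_mod_cast hα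
      field_simp
  have S_sq_le : S ^ 2 ≤ S := by
    have test := hv u
    rw [quadForm, ContinuousLinearMap.reApplyInnerSelf_apply, inner_v_u, inner_Tu_u,
      enorm_sq_eq_ofReal, RCLike.norm_of_nonneg S_nonneg, RCLike.ofReal_re] at test
    exact (ENNReal.ofReal_le_ofReal_iff S_nonneg).1 test
  nlinarith

theorem enorm_inner_sq_eq_zero (h : IsEigenbasis T e α) {v : H}
    (hv : ∀ x, ‖⟪v, x⟫_𝕜‖ₑ ^ 2 ≤ quadForm T x) {l : ι} (hl : α l = 0) :
    ‖⟪v, e l⟫_𝕜‖ₑ ^ 2 = 0 := by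
  simpa [h.quadForm_self, hl] using hv (e l)

theorem tsum_inv_mul_enorm_inner_sq_le_one (h : IsEigenbasis T e α) {v : H}
    (hv : ∀ x, ‖⟪v, x⟫_𝕜‖ₑ ^ 2 ≤ quadForm T x) :
    ∑' l, (α l : ℝ≥0∞)⁻¹ * ‖⟪v, e l⟫_𝕜‖ₑ ^ 2 ≤ 1 := by
  have term_eq : ∀ l, (α l : ℝ≥0∞)⁻¹ * ‖⟪v, e l⟫_𝕜‖ₑ ^ 2 =
      ENNReal.ofReal ((α l : ℝ)⁻¹ * ‖⟪v, e l⟫_𝕜‖ ^ 2) := fun l => by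
    by_cases hl : α l = 0
    · simp [h.enorm_inner_sq_eq_zero hv hl, hl]
    · rw [ENNReal.ofReal_mul (by positivity), ENNReal.ofReal_inv_of_pos (by positivity),
        ENNReal.ofReal_coe_nnreal, enorm_sq_eq_ofReal]
  rw [ENNReal.tsum_eq_iSup_sum]
  refine iSup_le fun s => ?_
  simp only [term_eq]
  rw [← ENNReal.ofReal_sum_of_nonneg fun l _ => by positivity]
  exact ENNReal.ofReal_le_one.2 (h.sum_inv_mul_norm_inner_sq_le_one hv s)

theorem tsum_inv_mul_enorm_inner_sq_mul (h : IsEigenbasis T e α) {v : H}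
    (hv : ∀ x, ‖⟪v, x⟫_𝕜‖ₑ ^ 2 ≤ quadForm T x) :
    ∑' l, (α l : ℝ≥0∞)⁻¹ * ‖⟪v, e l⟫_𝕜‖ₑ ^ 2 * α l = ‖v‖ₑ ^ 2 := by
  rw [← tsum_enorm_inner_sq e v]
  refine tsum_congr fun l => ?_
  rw [enorm_inner_comm (e l)]
  by_cases hl : α l = 0
  · simp [h.enorm_inner_sq_eq_zero hv hl]
  · rw [mul_right_comm, ENNReal.inv_mul_cancel (by simpa using hl) ENNReal.coe_ne_top, one_mul]

theorem tsum_enorm_sq_rpow_le (h : IsEigenbasis T e α) {v : κ → H}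
    (hv : ∀ x, ∑' k, ‖⟪v k, x⟫_𝕜‖ₑ ^ 2 ≤ quadForm T x) (hq : 1 ≤ q) :
    ∑' k, (‖v k‖ₑ ^ 2) ^ q ≤ ∑' l, (α l : ℝ≥0∞) ^ q := by
  have hvk : ∀ k x, ‖⟪v k, x⟫_𝕜‖ₑ ^ 2 ≤ quadForm T x :=
    fun k x => (ENNReal.le_tsum k).trans (hv x)
  calc ∑' k, (‖v k‖ₑ ^ 2) ^ q
      ≤ ∑' k, ∑' l, (α l : ℝ≥0∞)⁻¹ * ‖⟪v k, e l⟫_𝕜‖ₑ ^ 2 * (α l : ℝ≥0∞) ^ q := by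
        refine ENNReal.tsum_le_tsum fun k => ?_
        rw [← h.tsum_inv_mul_enorm_inner_sq_mul (hvk k)]
        exact rpow_tsum_mul_le_tsum_mul_rpow hq (h.tsum_inv_mul_enorm_inner_sq_le_one (hvk k))
    _ = ∑' l, (α l : ℝ≥0∞)⁻¹ * (∑' k, ‖⟪v k, e l⟫_𝕜‖ₑ ^ 2) * (α l : ℝ≥0∞) ^ q := by
        rw [ENNReal.tsum_comm]
        simp only [ENNReal.tsum_mul_left, ENNReal.tsum_mul_right]
    _ ≤ ∑' l, (α l : ℝ≥0∞) ^ q := by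
        refine ENNReal.tsum_le_tsum fun l => mul_le_of_le_one_left' ?_
        calc _ ≤ (α l : ℝ≥0∞)⁻¹ * α l := by
              gcongr
              exact (hv (e l)).trans_eq (h.quadForm_self l)
          _ ≤ 1 := ENNReal.inv_mul_le_one _

theorem tsum_rpow_le_tsum_enorm_sq_rpow (h : IsEigenbasis T e α) {v : κ → H}
    (hv : ∀ x, ∑' k, ‖⟪v k, x⟫_𝕜‖ₑ ^ 2 = quadForm T x) (hq0 : 0 < q) (hq : q ≤ 1) :
    ∑' l, (α l : ℝ≥0∞) ^ q ≤ ∑' k, (‖v k‖ₑ ^ 2) ^ q := by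
  have hvk : ∀ k x, ‖⟪v k, x⟫_𝕜‖ₑ ^ 2 ≤ quadForm T x :=
    fun k x => (ENNReal.le_tsum k).trans_eq (hv x)
  have weights_sum : ∀ l, (α l : ℝ≥0∞) ^ q =
      (α l : ℝ≥0∞)⁻¹ * (∑' k, ‖⟪v k, e l⟫_𝕜‖ₑ ^ 2) * (α l : ℝ≥0∞) ^ q := fun l => by
    rw [hv, h.quadForm_self]
    by_cases hl : α l = 0
    · simp [hl, hq0]
    · rw [ENNReal.inv_mul_cancel (by simpa using hl) ENNReal.coe_ne_top, one_mul]
  calc ∑' l, (α l : ℝ≥0∞) ^ q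
      = ∑' l, (α l : ℝ≥0∞)⁻¹ * (∑' k, ‖⟪v k, e l⟫_𝕜‖ₑ ^ 2) * (α l : ℝ≥0∞) ^ q :=
        tsum_congr weights_sum
    _ = ∑' k, ∑' l, (α l : ℝ≥0∞)⁻¹ * ‖⟪v k, e l⟫_𝕜‖ₑ ^ 2 * (α l : ℝ≥0∞) ^ q := by
        rw [ENNReal.tsum_comm]
        simp only [ENNReal.tsum_mul_left, ENNReal.tsum_mul_right]
    _ ≤ ∑' k, (‖v k‖ₑ ^ 2) ^ q := by
        refine ENNReal.tsum_le_tsum fun k => ?_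
        rw [← h.tsum_inv_mul_enorm_inner_sq_mul (hvk k)]
        exact tsum_mul_rpow_le_rpow_tsum_mul hq0 hq
          (h.tsum_inv_mul_enorm_inner_sq_le_one (hvk k))

end Frame

section Family

variable {n : Type*} [Fintype n] {κ : n → Type*} {S : n → H →L[𝕜] H}
  {g : ∀ i, HilbertBasis (κ i) 𝕜 H} {β : ∀ i, κ i → ℝ≥0}
  {T : H →L[𝕜] H} {e : HilbertBasis ι 𝕜 H} {α : ι → ℝ≥0} {q : ℝ}

theorem exists_sum_quadForm_eq_tsum (hg : ∀ i, IsEigenbasis (S i) (g i) (β i)) :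
    ∃ v : (Σ i, κ i) → H, (∀ k, ‖v k‖ₑ ^ 2 = β k.1 k.2) ∧
      ∀ x, ∑' k, ‖⟪v k, x⟫_𝕜‖ₑ ^ 2 = ∑ i, quadForm (S i) x := by
  refine ⟨fun k => ((NNReal.sqrt (β k.1 k.2) : ℝ) : 𝕜) • g k.1 k.2, fun k => ?_, fun x => ?_⟩
  · rw [enorm_sqrt_smul_sq, enorm_hilbertBasis, one_pow, mul_one]
  · simp only [inner_smul_left, RCLike.conj_ofReal, ← smul_eq_mul, enorm_sqrt_smul_sq]
    rw [ENNReal.tsum_sigma', tsum_fintype]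
    exact Finset.sum_congr rfl fun i _ => ((hg i).quadForm_eq_tsum x).symm

/-- **McCarthy's inequality**, convex case: `∑ i, Tr (S i) ^ q ≤ Tr T ^ q` if `∑ i, S i ≤ T`. -/
theorem sum_tsum_rpow_le (he : IsEigenbasis T e α) (hg : ∀ i, IsEigenbasis (S i) (g i) (β i))
    (hST : ∀ x, ∑ i, quadForm (S i) x ≤ quadForm T x) (hq : 1 ≤ q) :
    ∑ i, ∑' k, (β i k : ℝ≥0∞) ^ q ≤ ∑' l, (α l : ℝ≥0∞) ^ q := by
  obtain ⟨v, norm_v, frame_v⟩ := exists_sum_quadForm_eq_tsum hg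
  have h := he.tsum_enorm_sq_rpow_le (fun x => (frame_v x).trans_le (hST x)) hq
  simpa only [norm_v, ENNReal.tsum_sigma', tsum_fintype] using h

/-- **McCarthy's inequality**, concave case: `Tr T ^ q ≤ ∑ i, Tr (S i) ^ q` if `∑ i, S i = T`. -/
theorem tsum_rpow_le_sum (he : IsEigenbasis T e α) (hg : ∀ i, IsEigenbasis (S i) (g i) (β i))
    (hST : ∀ x, ∑ i, quadForm (S i) x = quadForm T x) (hq0 : 0 < q) (hq : q ≤ 1) :
    ∑' l, (α l : ℝ≥0∞) ^ q ≤ ∑ i, ∑' k, (β i k : ℝ≥0∞) ^ q := by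
  obtain ⟨v, norm_v, frame_v⟩ := exists_sum_quadForm_eq_tsum hg
  have h := he.tsum_rpow_le_tsum_enorm_sq_rpow (fun x => (frame_v x).trans (hST x)) hq0 hq
  simpa only [norm_v, ENNReal.tsum_sigma', tsum_fintype] using h

theorem tsum_rpow_le_card_rpow_mul_sum (he : IsEigenbasis T e α)
    (hg : ∀ i, IsEigenbasis (S i) (g i) (β i))
    (hST : ∀ x, quadForm T x ≤ ∑ i, quadForm (S i) x) (hq : 1 ≤ q) :
    ∑' l, (α l : ℝ≥0∞) ^ q ≤
      (Fintype.card n : ℝ≥0∞) ^ (q - 1) * ∑ i, ∑' k, (β i k : ℝ≥0∞) ^ q :=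
  calc ∑' l, (α l : ℝ≥0∞) ^ q
      ≤ ∑' l, (Fintype.card n : ℝ≥0∞) ^ (q - 1) * ∑ i, quadForm (S i) (e l) ^ q := by
        refine ENNReal.tsum_le_tsum fun l => ?_
        rw [← he.quadForm_self l]
        exact (ENNReal.rpow_le_rpow (hST (e l)) (by linarith)).trans
          (ENNReal.rpow_sum_le_const_mul_sum_rpow _ _ hq)
    _ = (Fintype.card n : ℝ≥0∞) ^ (q - 1) * ∑ i, ∑' l, quadForm (S i) (e l) ^ q := by
        rw [ENNReal.tsum_mul_left, Summable.tsum_finsetSum fun _ _ => ENNReal.summable]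
    _ ≤ (Fintype.card n : ℝ≥0∞) ^ (q - 1) * ∑ i, ∑' k, (β i k : ℝ≥0∞) ^ q := by
        gcongr with i
        exact (hg i).tsum_quadForm_rpow_le e hq

theorem sum_tsum_rpow_le_card_rpow_mul (he : IsEigenbasis T e α)
    (hg : ∀ i, IsEigenbasis (S i) (g i) (β i))
    (hST : ∀ x, ∑ i, quadForm (S i) x ≤ quadForm T x) (hq0 : 0 < q) (hq : q ≤ 1) :
    ∑ i, ∑' k, (β i k : ℝ≥0∞) ^ q ≤
      (Fintype.card n : ℝ≥0∞) ^ (1 - q) * ∑' l, (α l : ℝ≥0∞) ^ q :=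
  calc ∑ i, ∑' k, (β i k : ℝ≥0∞) ^ q
      ≤ ∑ i, ∑' l, quadForm (S i) (e l) ^ q :=
        Finset.sum_le_sum fun i _ => (hg i).tsum_rpow_le_tsum_quadForm_rpow e hq0 hq
    _ = ∑' l, ∑ i, quadForm (S i) (e l) ^ q :=
        (Summable.tsum_finsetSum fun _ _ => ENNReal.summable).symm
    _ ≤ ∑' l, (Fintype.card n : ℝ≥0∞) ^ (1 - q) * (α l : ℝ≥0∞) ^ q := by
        refine ENNReal.tsum_le_tsum fun l => ?_
        rw [← he.quadForm_self l]
        refine (sum_rpow_le_card_rpow_mul_rpow_sum _ _ hq0 hq).trans ?_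
        rw [Finset.card_univ]
        gcongr
        exact hST (e l)
    _ = (Fintype.card n : ℝ≥0∞) ^ (1 - q) * ∑' l, (α l : ℝ≥0∞) ^ q := ENNReal.tsum_mul_left

end Family

end IsEigenbasis

end InnerProductSpace

theorem isCompactOperator_of_norm_sq_le {𝕜 E F G : Type*} [NontriviallyNormedField 𝕜]
    [NormedAddCommGroup E] [NormedSpace 𝕜 E] [NormedAddCommGroup F] [NormedSpace 𝕜 F]
    [NormedAddCommGroup G] [NormedSpace 𝕜 G] [CompleteSpace G] {T : E →L[𝕜] F} {X : E →L[𝕜] G}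
    (hT : IsCompactOperator T) (hXT : ∀ x, ‖X x‖ ^ 2 ≤ ‖T x‖ * ‖x‖) : IsCompactOperator X := by
  rw [← ContinuousLinearMap.coe_coe,
    isCompactOperator_iff_isCompact_closure_image_closedBall _ one_pos]
  refine TotallyBounded.isCompact_of_isClosed (totallyBounded_closure.2 ?_) isClosed_closure
  refine Metric.totallyBounded_iff.2 fun ε hε => ?_
  have image_totallyBounded : TotallyBounded (T '' Metric.closedBall 0 1) :=
    (IsCompactOperator.isCompact_closure_image_closedBall (f := (T : E →ₗ[𝕜] F)) hT
      1).totallyBounded.subset subset_closure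
  obtain ⟨t, t_ball, t_finite, t_net⟩ := Set.exists_subset_image_finite_and.1
    (Metric.finite_approx_of_totallyBounded image_totallyBounded (ε ^ 2 / 2) (by positivity))
  refine ⟨X '' t, t_finite.image X, ?_⟩
  rintro _ ⟨x, x_ball, rfl⟩
  obtain ⟨_, ⟨y, y_mem, rfl⟩, Tx_near⟩ := Set.mem_iUnion₂.1 (t_net ⟨x, x_ball, rfl⟩)
  refine Set.mem_iUnion₂.2 ⟨X y, ⟨y, y_mem, rfl⟩, ?_⟩
  rw [ContinuousLinearMap.coe_coe]
  rw [mem_ball_iff_norm, ← map_sub] at Tx_near ⊢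
  have diff_norm_le : ‖x - y‖ ≤ 2 := by
    linarith [norm_sub_le x y, mem_closedBall_zero_iff.1 x_ball,
      mem_closedBall_zero_iff.1 (t_ball y_mem)]
  refine lt_of_pow_lt_pow_left₀ 2 hε.le ?_
  calc ‖X (x - y)‖ ^ 2 ≤ ‖T (x - y)‖ * ‖x - y‖ := hXT _
    _ ≤ ‖T (x - y)‖ * 2 := by gcongr
    _ < ε ^ 2 := by linarith

theorem exists_hilbertBasis_mem {𝕜 : Type*} {H : Type u} {ι : Type v} [RCLike 𝕜]
    [NormedAddCommGroup H] [InnerProductSpace 𝕜 H] [CompleteSpace H] {V : ι → Submodule 𝕜 H}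
    [∀ i, CompleteSpace (V i)]
    (hV : OrthogonalFamily 𝕜 (fun i => V i) fun i => (V i).subtypeₗᵢ) (hV' : (⨆ i, V i)ᗮ = ⊥) :
    ∃ (κ : Type (max u v)) (b : HilbertBasis κ 𝕜 H) (f : κ → ι), ∀ k, b k ∈ V (f k) := by
  choose w c _ using fun i => exists_hilbertBasis 𝕜 (V i)
  have c_orthonormal : Orthonormal 𝕜 fun k : Σ i, w i => (c k.1 k.2 : H) :=
    hV.orthonormal_sigma_orthonormal fun i => (c i).orthonormal
  have c_total : (Submodule.span 𝕜 (Set.range fun k : Σ i, w i => (c k.1 k.2 : H)))ᗮ = ⊥ := by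
    rw [eq_bot_iff, ← hV', ← Submodule.iInf_orthogonal, le_iInf_iff]
    intro i x hx
    have inner_basis : ∀ l, ⟪(c i l : H), x⟫_𝕜 = 0 := fun l =>
      Submodule.inner_right_of_mem_orthogonal
        (Submodule.subset_span (Set.mem_range.2 ⟨⟨i, l⟩, rfl⟩)) hx
    have projection := (c i).hasSum_orthogonalProjectionOnto x
    simp only [inner_basis, zero_smul] at projection
    exact Submodule.orthogonalProjectionOnto_eq_zero_iff.1 (projection.unique hasSum_zero)
  refine ⟨Σ i, w i, HilbertBasis.mkOfOrthogonalEqBot c_orthonormal c_total, Sigma.fst, fun k => ?_⟩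
  rw [HilbertBasis.coe_mkOfOrthogonalEqBot]
  exact (c k.1 k.2).2

theorem exists_isEigenbasis {𝕜 : Type v} {H : Type u} [RCLike 𝕜] [NormedAddCommGroup H]
    [InnerProductSpace 𝕜 H] [CompleteSpace H] {T : H →L[𝕜] H} (hc : IsCompactOperator T)
    (hT : T.IsPositive) :
    ∃ (ι : Type (max u v)) (b : HilbertBasis ι 𝕜 H) (a : ι → ℝ≥0), IsEigenbasis T b a := by
  obtain ⟨ι, b, μ, hb⟩ := exists_hilbertBasis_mem hT.isSymmetric.orthogonalFamily_eigenspaces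
    (ContinuousLinearMap.orthogonalComplement_iSup_eigenspaces_eq_bot hc hT.isSymmetric)
  have eigen : ∀ l, T (b l) = μ l • b l := fun l => mem_eigenspace_iff.1 (hb l)
  have eigenvalue_nonneg : ∀ l, 0 ≤ μ l := fun l => by
    have form_nonneg := hT.inner_nonneg_right (b l)
    rwa [eigen, inner_smul_right, inner_self_eq_one_of_norm_eq_one (b.orthonormal.1 l),
      mul_one] at form_nonneg
  choose a a_nonneg a_eq using fun l => RCLike.nonneg_iff_exists_ofReal.1 (eigenvalue_nonneg l)
  exact ⟨ι, b, fun l => ⟨a l, a_nonneg l⟩, fun l => (eigen l).trans (by rw [← a_eq]; rfl)⟩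

namespace IsEigenbasis

variable {𝕜 H ι : Type*} [RCLike 𝕜] [NormedAddCommGroup H] [InnerProductSpace 𝕜 H]
  {T : H →L[𝕜] H} {b : HilbertBasis ι 𝕜 H} {a : ι → ℝ≥0}

theorem inner_eq_zero_of_mem_eigenspace (h : IsEigenbasis T b a) {c : 𝕜} {x : H}
    (hx : x ∈ eigenspace (T : H →ₗ[𝕜] H) c) {l : ι} (hl : ((a l : ℝ) : 𝕜) ≠ c) :
    ⟪b l, x⟫_𝕜 = 0 := by
  have eigen := h.inner_apply l x
  rw [show T x = c • x from mem_eigenspace_iff.1 hx, inner_smul_right] at eigen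
  by_contra h0
  exact hl (mul_right_cancel₀ h0 eigen).symm

theorem finrank_eigenspace [CompleteSpace H] (h : IsEigenbasis T b a) (hc : IsCompactOperator T)
    {c : ℝ≥0} (hc0 : c ≠ 0) :
    (Module.finrank 𝕜 (eigenspace (T : H →ₗ[𝕜] H) ((c : ℝ) : 𝕜)) : ℕ∞) =
      ENat.card (a ⁻¹' {c}) := by
  have : FiniteDimensional 𝕜 (eigenspace (T : H →ₗ[𝕜] H) ((c : ℝ) : 𝕜)) :=
    ContinuousLinearMap.finite_dimensional_eigenspace hc _ (by simpa using hc0)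
  have basis_mem : ∀ l : a ⁻¹' {c}, b l ∈ eigenspace (T : H →ₗ[𝕜] H) ((c : ℝ) : 𝕜) := fun l =>
    mem_eigenspace_iff.2 ((h l).trans (by rw [show a l = c from l.2]))
  let v : a ⁻¹' {c} → eigenspace (T : H →ₗ[𝕜] H) ((c : ℝ) : 𝕜) :=
    Set.codRestrict (fun l : a ⁻¹' {c} => b l) _ basis_mem
  have v_orthonormal : Orthonormal 𝕜 v :=
    (b.orthonormal.comp _ Subtype.val_injective).codRestrict _ basis_mem
  have v_total : (Submodule.span 𝕜 (Set.range v))ᗮ = ⊥ := by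
    refine (Submodule.eq_bot_iff _).2 fun x hx => ?_
    have inner_basis : ∀ l, ⟪b l, (x : H)⟫_𝕜 = 0 := fun l => by
      by_cases hl : a l = c
      · exact (Submodule.mem_orthogonal _ _).1 hx _
          (Submodule.subset_span (Set.mem_range_self ⟨l, hl⟩))
      · exact h.inner_eq_zero_of_mem_eigenspace x.2 (by simpa using hl)
    have expansion := b.hasSum_repr (x : H)
    simp only [b.repr_apply_apply, inner_basis, zero_smul] at expansion
    exact Subtype.ext (expansion.unique hasSum_zero)
  have := v_orthonormal.linearIndependent.finite
  have := Fintype.ofFinite (a ⁻¹' {c})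
  rw [Module.finrank_eq_card_basis
    (OrthonormalBasis.mkOfOrthogonalEqBot v_orthonormal v_total).toBasis,
    ENat.card_eq_coe_fintype_card]

end IsEigenbasis

section SchattenNorm

open ContinuousLinearMap (adjoint)

section AdjointMul

variable {𝕜 H : Type*} [RCLike 𝕜] [NormedAddCommGroup H] [InnerProductSpace 𝕜 H] [CompleteSpace H]

theorem quadForm_adjoint_mul (X : H →L[𝕜] H) (x : H) :
    quadForm (adjoint X * X) x = ‖X x‖ₑ ^ 2 := by
  rw [enorm_sq_eq_ofReal, X.apply_norm_sq_eq_inner_adjoint_left]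
  rfl

variable {m n : Type*} [Fintype m] [Fintype n] {X : m → H →L[𝕜] H} {Y : n → H →L[𝕜] H}

theorem quadForm_sum_adjoint_mul (Y : n → H →L[𝕜] H) (x : H) :
    quadForm (∑ j, adjoint (Y j) * Y j) x = ∑ j, ‖Y j x‖ₑ ^ 2 := by
  simp only [enorm_sq_eq_ofReal]
  rw [← ENNReal.ofReal_sum_of_nonneg fun j _ => by positivity, quadForm,
    ContinuousLinearMap.reApplyInnerSelf_apply, sum_apply, sum_inner, map_sum]
  simp only [ContinuousLinearMap.apply_norm_sq_eq_inner_adjoint_left]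
  rfl

theorem isCompactOperator_sum_adjoint_mul (hY : ∀ j, IsCompactOperator (Y j)) :
    IsCompactOperator (∑ j, adjoint (Y j) * Y j : H →L[𝕜] H) :=
  Submodule.sum_mem (compactOperator (RingHom.id 𝕜) H H) fun j _ => (hY j).clm_comp (adjoint (Y j))

theorem isCompactOperator_of_sum_enorm_sq_le (hY : ∀ j, IsCompactOperator (Y j))
    (hXY : ∀ x, ∑ i, ‖X i x‖ₑ ^ 2 ≤ ∑ j, ‖Y j x‖ₑ ^ 2) (i : m) : IsCompactOperator (X i) := by
  refine isCompactOperator_of_norm_sq_le (isCompactOperator_sum_adjoint_mul hY) fun x => ?_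
  rw [← ENNReal.ofReal_le_ofReal_iff (by positivity), ← enorm_sq_eq_ofReal]
  calc ‖X i x‖ₑ ^ 2 ≤ ∑ i, ‖X i x‖ₑ ^ 2 :=
        Finset.single_le_sum (f := fun i => ‖X i x‖ₑ ^ 2) (fun _ _ => zero_le) (Finset.mem_univ i)
    _ ≤ quadForm (∑ j, adjoint (Y j) * Y j) x :=
        (hXY x).trans_eq (quadForm_sum_adjoint_mul Y x).symm
    _ ≤ ENNReal.ofReal (‖(∑ j, adjoint (Y j) * Y j) x‖ * ‖x‖) :=
        ENNReal.ofReal_le_ofReal (re_inner_le_norm _ _)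

theorem exists_isEigenbasis_sum_adjoint_mul {𝕜 : Type v} {H : Type u} [RCLike 𝕜]
    [NormedAddCommGroup H] [InnerProductSpace 𝕜 H] [CompleteSpace H] {Y : n → H →L[𝕜] H}
    (hY : ∀ j, IsCompactOperator (Y j)) :
    ∃ (ι : Type (max u v)) (e : HilbertBasis ι 𝕜 H) (α : ι → ℝ≥0),
      IsEigenbasis (∑ j, adjoint (Y j) * Y j) e α :=
  exists_isEigenbasis (isCompactOperator_sum_adjoint_mul hY) <|
    ContinuousLinearMap.isPositive_sum _ fun j _ =>
      ContinuousLinearMap.isPositive_adjoint_comp_self (Y j)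

theorem exists_isEigenbasis_adjoint_mul {𝕜 : Type v} {H : Type u} [RCLike 𝕜]
    [NormedAddCommGroup H] [InnerProductSpace 𝕜 H] [CompleteSpace H] {X : H →L[𝕜] H}
    (hX : IsCompactOperator X) :
    ∃ (ι : Type (max u v)) (b : HilbertBasis ι 𝕜 H) (a : ι → ℝ≥0),
      IsEigenbasis (adjoint X * X) b a :=
  exists_isEigenbasis (hX.clm_comp (adjoint X))
    (ContinuousLinearMap.isPositive_adjoint_comp_self X)

end AdjointMul

variable {H : Type*} [NormedAddCommGroup H] [InnerProductSpace ℂ H] [CompleteSpace H]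
  {p : ℝ}

theorem IsEigenbasis.singularMultiplicity_eq_card {ι : Type*} {X : H →L[ℂ] H}
    {b : HilbertBasis ι ℂ H} {a : ι → ℝ≥0} (h : IsEigenbasis (adjoint X * X) b a)
    (hX : IsCompactOperator X) {σ : ℝ} (hσ : 0 < σ) :
    (singularMultiplicity X σ : ℕ∞) = ENat.card (a ⁻¹' {Real.toNNReal σ ^ 2}) := by
  rw [← h.finrank_eigenspace (hX.clm_comp (adjoint X)) (by positivity), singularMultiplicity,
    NNReal.coe_pow, Real.coe_toNNReal σ hσ.le]
  rfl

theorem IsEigenbasis.eSchattenNorm_rpow {ι : Type*} {X : H →L[ℂ] H}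
    {b : HilbertBasis ι ℂ H} {a : ι → ℝ≥0} (h : IsEigenbasis (adjoint X * X) b a)
    (hX : IsCompactOperator X) (hp : 0 < p) :
    eSchattenNorm p X ^ p = ∑' l, (a l : ℝ≥0∞) ^ (p / 2) := by
  have hp2 : 0 < p / 2 := by positivity
  rw [eSchattenNorm, ← ENNReal.rpow_mul, one_div_mul_cancel hp.ne', ENNReal.rpow_one,
    tsum_comp_eq_tsum_card_fiber_mul a fun c => (c : ℝ≥0∞) ^ (p / 2),
    ← tsum_Ioi_toNNReal_sq (by simp [hp2])]
  refine tsum_congr fun σ => ?_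
  rw [← h.singularMultiplicity_eq_card hX σ.2, ENat.toENNReal_coe, ENNReal.coe_pow,
    ENNReal.ofReal, ← ENNReal.rpow_two, ← ENNReal.rpow_mul, mul_div_cancel₀ p two_ne_zero]

variable {m n : Type*} [Fintype m] [Fintype n] {X : m → H →L[ℂ] H} {Y : n → H →L[ℂ] H}

theorem sum_eSchattenNorm_rpow_le_of_two_le (hp : 2 ≤ p) (hY : ∀ j, IsCompactOperator (Y j))
    (hXY : ∀ x, ∑ i, ‖X i x‖ₑ ^ 2 ≤ ∑ j, ‖Y j x‖ₑ ^ 2) :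
    ∑ i, eSchattenNorm p (X i) ^ p ≤
      (Fintype.card n : ℝ≥0∞) ^ (p / 2 - 1) * ∑ j, eSchattenNorm p (Y j) ^ p := by
  have hX := isCompactOperator_of_sum_enorm_sq_le hY hXY
  obtain ⟨_, e, α, he⟩ := exists_isEigenbasis_sum_adjoint_mul hY
  choose _ f β hf using fun i => exists_isEigenbasis_adjoint_mul (hX i)
  choose _ g γ hg using fun j => exists_isEigenbasis_adjoint_mul (hY j)
  simp only [(hf _).eSchattenNorm_rpow (hX _) (by linarith),
    (hg _).eSchattenNorm_rpow (hY _) (by linarith)]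
  calc ∑ i, ∑' k, (β i k : ℝ≥0∞) ^ (p / 2)
      ≤ ∑' l, (α l : ℝ≥0∞) ^ (p / 2) := by
        refine he.sum_tsum_rpow_le hf (fun x => ?_) (by linarith)
        simpa only [quadForm_adjoint_mul, quadForm_sum_adjoint_mul] using hXY x
    _ ≤ (Fintype.card n : ℝ≥0∞) ^ (p / 2 - 1) * ∑ j, ∑' k, (γ j k : ℝ≥0∞) ^ (p / 2) := by
        refine he.tsum_rpow_le_card_rpow_mul_sum hg (fun x => ?_) (by linarith)
        simp only [quadForm_adjoint_mul, quadForm_sum_adjoint_mul, le_refl]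

theorem sum_eSchattenNorm_rpow_le_of_le_two (hp0 : 0 < p) (hp : p ≤ 2)
    (hY : ∀ j, IsCompactOperator (Y j))
    (hXY : ∀ x, ∑ i, ‖X i x‖ₑ ^ 2 ≤ ∑ j, ‖Y j x‖ₑ ^ 2) :
    ∑ i, eSchattenNorm p (X i) ^ p ≤
      (Fintype.card m : ℝ≥0∞) ^ (1 - p / 2) * ∑ j, eSchattenNorm p (Y j) ^ p := by
  have hX := isCompactOperator_of_sum_enorm_sq_le hY hXY
  obtain ⟨_, e, α, he⟩ := exists_isEigenbasis_sum_adjoint_mul hY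
  choose _ f β hf using fun i => exists_isEigenbasis_adjoint_mul (hX i)
  choose _ g γ hg using fun j => exists_isEigenbasis_adjoint_mul (hY j)
  simp only [(hf _).eSchattenNorm_rpow (hX _) hp0, (hg _).eSchattenNorm_rpow (hY _) hp0]
  calc ∑ i, ∑' k, (β i k : ℝ≥0∞) ^ (p / 2)
      ≤ (Fintype.card m : ℝ≥0∞) ^ (1 - p / 2) * ∑' l, (α l : ℝ≥0∞) ^ (p / 2) := by
        refine he.sum_tsum_rpow_le_card_rpow_mul hf (fun x => ?_) (by linarith) (by linarith)
        simpa only [quadForm_adjoint_mul, quadForm_sum_adjoint_mul] using hXY x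
    _ ≤ (Fintype.card m : ℝ≥0∞) ^ (1 - p / 2) * ∑ j, ∑' k, (γ j k : ℝ≥0∞) ^ (p / 2) := by
        gcongr
        refine he.tsum_rpow_le_sum hg (fun x => ?_) (by linarith) (by linarith)
        simp only [quadForm_adjoint_mul, quadForm_sum_adjoint_mul]

theorem memSchatten_and_sum_schattenNorm_rpow_le_of_two_le (hp : 2 ≤ p)
    (hY : ∀ j, MemSchatten p (Y j)) (hXY : ∀ x, ∑ i, ‖X i x‖ₑ ^ 2 ≤ ∑ j, ‖Y j x‖ₑ ^ 2) :
    (∀ i, MemSchatten p (X i)) ∧ ∑ i, schattenNorm p (X i) ^ p ≤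
      (Fintype.card n : ℝ) ^ (p / 2 - 1) * ∑ j, schattenNorm p (Y j) ^ p := by
  have hYc := fun j => (hY j).isCompactOperator
  obtain ⟨hX, h⟩ := ne_top_and_sum_toReal_rpow_le (by linarith) (by linarith)
    (fun j => (hY j).eSchattenNorm_lt_top.ne) (sum_eSchattenNorm_rpow_le_of_two_le hp hYc hXY)
  exact ⟨fun i => ⟨isCompactOperator_of_sum_enorm_sq_le hYc hXY i, (hX i).lt_top⟩, h⟩

theorem memSchatten_and_sum_schattenNorm_rpow_le_of_le_two (hp0 : 0 < p) (hp : p ≤ 2)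
    (hY : ∀ j, MemSchatten p (Y j)) (hXY : ∀ x, ∑ i, ‖X i x‖ₑ ^ 2 ≤ ∑ j, ‖Y j x‖ₑ ^ 2) :
    (∀ i, MemSchatten p (X i)) ∧ ∑ i, schattenNorm p (X i) ^ p ≤
      (Fintype.card m : ℝ) ^ (1 - p / 2) * ∑ j, schattenNorm p (Y j) ^ p := by
  have hYc := fun j => (hY j).isCompactOperator
  obtain ⟨hX, h⟩ := ne_top_and_sum_toReal_rpow_le hp0 (by linarith)
    (fun j => (hY j).eSchattenNorm_lt_top.ne) (sum_eSchattenNorm_rpow_le_of_le_two hp0 hp hYc hXY)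
  exact ⟨fun i => ⟨isCompactOperator_of_sum_enorm_sq_le hYc hXY i, (hX i).lt_top⟩, h⟩

theorem schattenNorm_nonneg (X : H →L[ℂ] H) : 0 ≤ schattenNorm p X :=
  ENNReal.toReal_nonneg

theorem sum_enorm_sq_eq_of_sum_abs_sq_eq
    (hXY : ∑ i, CFC.abs (X i) ^ 2 = ∑ j, CFC.abs (Y j) ^ 2) (x : H) :
    ∑ i, ‖X i x‖ₑ ^ 2 = ∑ j, ‖Y j x‖ₑ ^ 2 := by
  simp only [CFC.abs_sq, ContinuousLinearMap.star_eq_adjoint] at hXY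
  rw [← quadForm_sum_adjoint_mul, hXY, quadForm_sum_adjoint_mul]

end SchattenNorm

theorem corollary1p8_general {H m n : Type*} [NormedAddCommGroup H] [InnerProductSpace ℂ H]
    [CompleteSpace H] [Fintype m] [Fintype n] {p : ℝ} (hp : 0 < p) {X : m → H →L[ℂ] H}
    {Y : n → H →L[ℂ] H} (hY : ∀ j, MemSchatten p (Y j))
    (hXY : ∑ i, CFC.abs (X i) ^ 2 = ∑ j, CFC.abs (Y j) ^ 2) :
    (∀ i, MemSchatten p (X i)) ∧
    (2 ≤ p →
      (Fintype.card m : ℝ) ^ (1 - p / 2) * ∑ j, schattenNorm p (Y j) ^ p ≤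
        ∑ i, schattenNorm p (X i) ^ p ∧
      ∑ i, schattenNorm p (X i) ^ p ≤
        (Fintype.card n : ℝ) ^ (p / 2 - 1) * ∑ j, schattenNorm p (Y j) ^ p) ∧
    (p ≤ 2 →
      (Fintype.card n : ℝ) ^ (p / 2 - 1) * ∑ j, schattenNorm p (Y j) ^ p ≤
        ∑ i, schattenNorm p (X i) ^ p ∧
      ∑ i, schattenNorm p (X i) ^ p ≤
        (Fintype.card m : ℝ) ^ (1 - p / 2) * ∑ j, schattenNorm p (Y j) ^ p) := by
  have le_XY := fun x => (sum_enorm_sq_eq_of_sum_abs_sq_eq hXY x).le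
  have le_YX := fun x => (sum_enorm_sq_eq_of_sum_abs_sq_eq hXY x).ge
  have hX : ∀ i, MemSchatten p (X i) := (le_total 2 p).elim
    (fun h => (memSchatten_and_sum_schattenNorm_rpow_le_of_two_le h hY le_XY).1)
    (fun h => (memSchatten_and_sum_schattenNorm_rpow_le_of_le_two hp h hY le_XY).1)
  refine ⟨hX, fun h => ⟨?_, ?_⟩, fun h => ⟨?_, ?_⟩⟩
  · rw [← neg_sub, Real.rpow_neg (Nat.cast_nonneg _)]
    exact inv_mul_le_of_le_mul₀ (by positivity)
      (Finset.sum_nonneg fun _ _ => Real.rpow_nonneg (schattenNorm_nonneg _) p)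
      (memSchatten_and_sum_schattenNorm_rpow_le_of_two_le h hX le_YX).2
  · exact (memSchatten_and_sum_schattenNorm_rpow_le_of_two_le h hY le_XY).2
  · rw [← neg_sub, Real.rpow_neg (Nat.cast_nonneg _)]
    exact inv_mul_le_of_le_mul₀ (by positivity)
      (Finset.sum_nonneg fun _ _ => Real.rpow_nonneg (schattenNorm_nonneg _) p)
      (memSchatten_and_sum_schattenNorm_rpow_le_of_le_two hp h hX le_YX).2
  · exact (memSchatten_and_sum_schattenNorm_rpow_le_of_le_two hp h hY le_XY).2

theorem corollary1p8 {H : Type*} [NormedAddCommGroup H] [InnerProductSpace ℂ H]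
    [CompleteSpace H] (p : ℝ) (hp : 0 < p) (s t : ℕ) (hs : 1 ≤ s) (ht : 1 ≤ t)
    (X : Fin s → H →L[ℂ] H) (Y : Fin t → H →L[ℂ] H)
    (hX : ∀ i, MemSchatten p (X i)) (hY : ∀ j, MemSchatten p (Y j))
    (hXY : ∑ i, CFC.abs (X i) ^ 2 = ∑ j, CFC.abs (Y j) ^ 2) :
    (2 ≤ p →
      (s : ℝ) ^ (1 - p / 2) * ∑ j, schattenNorm p (Y j) ^ p ≤ ∑ i, schattenNorm p (X i) ^ p ∧
      ∑ i, schattenNorm p (X i) ^ p ≤ (t : ℝ) ^ (p / 2 - 1) * ∑ j, schattenNorm p (Y j) ^ p) ∧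
    (p ≤ 2 →
      (t : ℝ) ^ (p / 2 - 1) * ∑ j, schattenNorm p (Y j) ^ p ≤ ∑ i, schattenNorm p (X i) ^ p ∧
      ∑ i, schattenNorm p (X i) ^ p ≤ (s : ℝ) ^ (1 - p / 2) * ∑ j, schattenNorm p (Y j) ^ p) := by
  simpa only [Fintype.card_fin] using (corollary1p8_general hp hY hXY).2
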